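/- **Definitions.** Let $R=\mathbb C[x_1,\dots,x_n]$, let $P=(0,\dots,0)\in\mathbb C^n$, let $\mathcal O_P$ be the localization of $R$ at the maximal ideal $(x_1,\dots,x_n)$, with maximal ideal $\mathfrak m_P$, and let $\mathfrak a\subset R$ be a nonzero ideal contained in $(x_1,\dots,x_n)$. *Log canonical threshold.* If $\mathfrak a=(f_1,\dots,f_r)$, then $$\mathrm{lct}_P(\mathfrak a)=\sup\Big\{s>0\ \Big|\ \frac{1}{(\sum_{i=1}^r|f_i|^2)^s}\ \text{is Lebesgue integrable on some neighbourhood of } P \text{ in }\mathbb C^n\Big\}.$$ *G-stable rank.* A system of local parameters at $P$ is a tuple $T=(y_1,\dots,y_n)$ of elements of $\mathfrak m_P$ whose images form a basis of $\mathfrak m_P/\mathfrak m_P^2$. Every $f\in\mathcal O_P$ has a unique Taylor series in $T$, that is, a power series $F=\sum_u c_u y^u$ with $f-\sum_{|u|<N}c_uy^u\in\mathfrak m_P^N$ for all $N$, and $F\in\mathbb C\{y_1,\dots,y_n\}$ is convergent. For $\lambda\in\mathbb Z_{\ge0}^n$, let $\mathrm{val}^T_\lambda(f)$ be the largest integer $k\ge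 0$ such that $F(t^{\lambda_1}y_1,\dots,t^{\lambda_n}y_n)=t^k g(y_1,\dots,y_n,t)$ for some $g\in\mathbb C\{y_1,\dots,y_n,t\}$ (and $\mathrm{val}^T_\lambda(0)=\infty$). Put $$\mathrm{ord}^T_\lambda(\mathfrak a)=\min_{f\in\mathfrak a}\mathrm{val}^T_\lambda(f),\qquad \mathrm{rk}^G(P,\mathfrak a)=\inf_T\ \inf_{0\ne\lambda\in\mathbb Z^n_{\ge0}}\frac{\sum_{i=1}^n\lambda_i}{\mathrm{ord}^T_\lambda(\mathfrak a)},$$ where $T$ runs over all systems of local parameters at $P$ and a quotient with denominator $0$ is read as $+\infty$. **Theorem.** Let $\mathfrak a\subset\mathbb C[x_1,\dots,x_n]$ be a proper nonzero ideal generated by monomials, and let $P=(0,\dots,0)$ be the origin. Then, for any finite set of generators $f_1,\dots,f_r$ of $\mathfrak a$ used to compute the left-hand side, $$\mathrm{lct}_P(\mathfrak a)=\mathrm{rk}^G(P,\mathfrak a).$$ -/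

import Mathlib

open scoped ENNReal Topology

noncomputable section

namespace GStable

/-- A formal power series in finitely many variables over `ℂ` is convergent if it converges
absolutely on some polydisc of positive radius, i.e. if it lies in `ℂ{σ}`. -/
def IsConvergent {σ : Type*} (F : MvPowerSeries σ ℂ) : Prop :=
  ∃ r : ℝ, 0 < r ∧ Summable fun u : σ →₀ ℕ => ‖MvPowerSeries.coeff u F‖ * r ^ u.degree

/-- The power series `F(t ^ λ₁ x₁, …, t ^ λₙ xₙ)` in the variables `x₁, …, xₙ, t`, where `x i` is
the variable `X (some i)` and `t` is the variable `X none`. -/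
def scale {n : ℕ} (l : Fin n → ℕ) (F : MvPowerSeries (Fin n) ℂ) :
    MvPowerSeries (Option (Fin n)) ℂ :=
  F.subst fun i : Fin n =>
    (MvPowerSeries.X none ^ l i * MvPowerSeries.X (some i) : MvPowerSeries (Option (Fin n)) ℂ)

/-- The valuation of a convergent power series `F` with weights `l`: the largest `k` such that
`F(t ^ λ₁ x₁, …, t ^ λₙ xₙ) = t ^ k * g(x₁, …, xₙ, t)` for a convergent power series `g`
(it is `⊤` for `F = 0`). -/
def valuation {n : ℕ} (l : Fin n → ℕ) (F : MvPowerSeries (Fin n) ℂ) : ℕ∞ :=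
  sSup {v : ℕ∞ | ∃ k : ℕ, v = k ∧ ∃ g : MvPowerSeries (Option (Fin n)) ℂ,
    IsConvergent g ∧ scale l F = MvPowerSeries.X none ^ k * g}

section LocalRing

variable {R : Type*} [CommRing R] [Algebra ℂ R] (P : Ideal R) [P.IsPrime]

/-- `T = (x₁, …, xₙ)` is a system of local parameters at `P`: the `xᵢ` lie in the maximal ideal
`𝔪` of the local ring at `P`, and their images form a basis of `𝔪 / 𝔪 ^ 2` over the residue
field. -/
def IsLocalParameters {n : ℕ} (T : Fin n → Localization.AtPrime P) : Prop :=
  ∃ hT : ∀ i, T i ∈ IsLocalRing.maximalIdeal (Localization.AtPrime P),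
    let b : Fin n → IsLocalRing.CotangentSpace (Localization.AtPrime P) := fun i =>
      (IsLocalRing.maximalIdeal (Localization.AtPrime P)).toCotangent ⟨T i, hT i⟩
    LinearIndependent (IsLocalRing.ResidueField (Localization.AtPrime P)) b ∧
      Submodule.span (IsLocalRing.ResidueField (Localization.AtPrime P)) (Set.range b) = ⊤

/-- `F` is the Taylor series of the germ `f` in the system of local parameters `T`: for every `N`
the partial sum of the terms of degree `< N` of `F`, evaluated at `T`, agrees with `f` modulo
`𝔪 ^ N`. At a nonsingular closed point of a complex variety every `f` has exactly one Taylor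
series, and it is convergent; this is the inclusion of the local ring into `ℂ{x₁, …, xₙ}`. -/
def IsTaylorSeries {n : ℕ} (T : Fin n → Localization.AtPrime P) (f : Localization.AtPrime P)
    (F : MvPowerSeries (Fin n) ℂ) : Prop :=
  ∀ N : ℕ, f - MvPolynomial.aeval T (MvPowerSeries.truncTotal N F) ∈
    IsLocalRing.maximalIdeal (Localization.AtPrime P) ^ N

/-- The order of the ideal `a` with respect to the local parameters `T` and the weights `l`: the
minimum over `f ∈ a` of the valuation of the power series expansion of `f` in `T`. -/
def order {n : ℕ} (T : Fin n → Localization.AtPrime P) (l : Fin n → ℕ) (a : Ideal R) : ℕ∞ :=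
  sInf {v : ℕ∞ | ∃ f ∈ a, ∃ F : MvPowerSeries (Fin n) ℂ,
    IsTaylorSeries P T (algebraMap R (Localization.AtPrime P) f) F ∧ v = valuation l F}

/-- The slope `(λ₁ + ⋯ + λₙ) / ord`, equal to `∞` if `ord = 0` and some `λᵢ` is positive. -/
def slope {n : ℕ} (T : Fin n → Localization.AtPrime P) (l : Fin n → ℕ) (a : Ideal R) : ℝ≥0∞ :=
  ((∑ i, l i : ℕ) : ℝ≥0∞) / (order P T l a : ℝ≥0∞)

/-- The `T`-stable rank: the infimum of the slope over all nonzero weights (for the zero weight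
the slope would read `0 / 0`). -/
def tStableRank {n : ℕ} (T : Fin n → Localization.AtPrime P) (a : Ideal R) : ℝ≥0∞ :=
  ⨅ (l : Fin n → ℕ) (_ : l ≠ 0), slope P T l a

/-- The `G`-stable rank of `a` at a point `P` of an `n`-dimensional variety: the infimum of the
`T`-stable ranks over all systems `T` of local parameters at `P`. -/
def gStableRank (n : ℕ) (a : Ideal R) : ℝ≥0∞ :=
  ⨅ (T : Fin n → Localization.AtPrime P) (_ : IsLocalParameters P T), tStableRank P T a

end LocalRing

/-- The log canonical threshold at `p` of the ideal generated by `f₁, …, fᵣ`: the supremum of the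
`s > 0` such that `1 / (∑ |fᵢ| ^ 2) ^ s` (which is `∞` at the common zeros of the `fᵢ`) has finite
integral over some neighbourhood of `p`. -/
def lct {n r : ℕ} (p : Fin n → ℂ) (f : Fin r → MvPolynomial (Fin n) ℂ) : ℝ≥0∞ :=
  ⨆ (s : ℝ) (_ : 0 < s ∧ ∃ U ∈ 𝓝 p,
      ∫⁻ z in U, 1 / (ENNReal.ofReal (∑ i, ‖MvPolynomial.eval z (f i)‖ ^ 2)) ^ s < ∞),
    ENNReal.ofReal s

/-- An ideal of the polynomial ring generated by monomials. -/
def IsMonomialIdeal {n : ℕ} (a : Ideal (MvPolynomial (Fin n) ℂ)) : Prop :=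
  ∃ S : Set (Fin n →₀ ℕ), a = Ideal.span ((fun u => MvPolynomial.monomial u (1 : ℂ)) '' S)

end GStable

end

open scoped ENNReal Topology

noncomputable section

namespace GStable


/-! Both sides are controlled by the Newton polyhedron of the ideal, through the exponents `u` of
the monomials that occur in the generators. For `lct ≤ rk`, fix local parameters `T` and weights
`l`. The standard coordinates expand in `T` with invertible linear part, so some permutation `τ`
makes the order in `T` at most the weight of every monomial of the ideal for `l ∘ τ`
(`exists_perm_order_le`). Integrating over polydiscs of radii `ε * t ^ l i`, with `l` the permuted
weights, and letting `t → 0` bounds each admissible `s` by the slope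
(`mul_le_sum_of_lintegral_lt_top`). For `rk ≤ lct`, the standard coordinates alone give a family of
linear inequalities, one for each weight. By Hahn–Banach some convex combination of the exponents
has all entries below `1 / s` (`exists_convex_weights`). Weighted AM-GM then bounds the integrand by
a product of one-variable powers `‖z i‖ ^ (-b i)` with `b i < 2`
(`lintegral_lt_top_of_convex_weights`). -/

/-! ### Weighted orders and linear coefficients of products. -/

-- Without zero divisors the product of the two initial forms is nonzero, and it is the component of
-- the product in degree `p + q`.
open MvPowerSeries in
theorem weightedOrder_mul {σ R : Type*} [Semiring R] [NoZeroDivisors R] (w : σ → ℕ)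
    (F G : MvPowerSeries σ R) :
    (F * G).weightedOrder w = F.weightedOrder w + G.weightedOrder w := by
  refine le_antisymm ?_ (le_weightedOrder_mul w)
  by_cases hF : F = 0
  · simp [hF]
  by_cases hG : G = 0
  · simp [hG]
  have hp := (ne_zero_iff_weightedOrder_finite w).1 hF
  have hq := (ne_zero_iff_weightedOrder_finite w).1 hG
  set p := (F.weightedOrder w).toNat
  set q := (G.weightedOrder w).toNat
  rw [← hp, ← hq]
  by_contra! h
  have h0 := weightedHomogeneousComponent_mul_of_le_weightedOrder hp.le hq.le
  rw [weightedHomogeneousComponent_of_lt_weightedOrder_eq_zero (by exact_mod_cast h)] at h0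
  exact mul_ne_zero (weightedHomogeneousComponent_of_weightedOrder hp)
    (weightedHomogeneousComponent_of_weightedOrder hq) h0.symm

theorem coeff_single_mul {σ R : Type*} [CommSemiring R] (k : σ) (F G : MvPowerSeries σ R) :
    (F * G).coeff (Finsupp.single k 1) =
      F.constantCoeff * G.coeff (Finsupp.single k 1) +
        F.coeff (Finsupp.single k 1) * G.constantCoeff := by
  classical
  rw [MvPowerSeries.coeff_mul, Finsupp.antidiagonal_single]
  simp [Finset.Nat.antidiagonal_succ]

/-! ### Comparison of the valuation with the weighted order. -/

section Valuation

variable {n : ℕ} (l : Fin n → ℕ)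

theorem hasSubst_scale : MvPowerSeries.HasSubst fun i : Fin n =>
    (MvPowerSeries.X none ^ l i * MvPowerSeries.X (some i) : MvPowerSeries (Option (Fin n)) ℂ) :=
  MvPowerSeries.hasSubst_of_constantCoeff_zero fun i => by simp

/-- The exponent of the monomial `F(t ^ λ₁ x₁, …, t ^ λₙ xₙ)` for `F = x ^ d`. -/
def scaleExponent (d : Fin n →₀ ℕ) : Option (Fin n) →₀ ℕ :=
  Finsupp.equivFunOnFinite.symm fun o => o.elim (Finsupp.weight l d) d

theorem scaleExponent_injective : Function.Injective (scaleExponent l) := by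
  intro d e h
  ext i
  simpa [scaleExponent] using DFunLike.congr_fun h (some i)

theorem prod_scale (d : Fin n →₀ ℕ) :
    (d.prod fun i e => (MvPowerSeries.X none ^ l i * MvPowerSeries.X (some i) :
      MvPowerSeries (Option (Fin n)) ℂ) ^ e) = MvPowerSeries.monomial (scaleExponent l d) 1 := by
  rw [MvPowerSeries.monomial_one_eq, Finsupp.prod_fintype _ _ (by simp),
    Finsupp.prod_fintype _ _ (by simp), Fintype.prod_option]
  simp only [mul_pow, Finset.prod_mul_distrib]
  congr 1
  rw [← Finset.prod_congr rfl fun i _ => pow_mul _ _ _, Finset.prod_pow_eq_pow_sum]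
  simp [scaleExponent, Finsupp.weight_apply, Finsupp.sum_fintype, mul_comm]

theorem coeff_scale (F : MvPowerSeries (Fin n) ℂ) (d : Fin n →₀ ℕ) :
    MvPowerSeries.coeff (scaleExponent l d) (scale l F) = MvPowerSeries.coeff d F := by
  classical
  rw [scale, MvPowerSeries.coeff_subst (hasSubst_scale l), finsum_eq_single _ d]
  · rw [prod_scale]; simp
  · intro e he
    rw [prod_scale, MvPowerSeries.coeff_monomial, if_neg, smul_zero]
    exact fun h => he (scaleExponent_injective l h).symm

/-- Scaling sends distinct monomials to distinct monomials and records the weight as the exponent of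
`t`, so divisibility by `t ^ k` kills every coefficient of weight below `k`. -/
theorem valuation_le_weightedOrder (F : MvPowerSeries (Fin n) ℂ) :
    valuation l F ≤ F.weightedOrder l := by
  refine sSup_le ?_
  rintro _ ⟨k, rfl, g, -, hg⟩
  refine MvPowerSeries.nat_le_weightedOrder l fun d hd => ?_
  rw [← coeff_scale l]
  refine MvPowerSeries.X_pow_dvd_iff.1 (Dvd.intro g hg.symm) _ ?_
  simpa [scaleExponent] using hd

theorem isConvergent_coe {σ : Type*} (q : MvPolynomial σ ℂ) :
    IsConvergent (q : MvPowerSeries σ ℂ) := by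
  refine ⟨1, one_pos, summable_of_ne_finset_zero (s := q.support) fun u hu => ?_⟩
  simp [MvPolynomial.notMem_support_iff.1 hu]

/-- For polynomials the cofactor of `t ^ k` is again a polynomial, so its convergence is automatic.
-/
theorem le_valuation_coe {k : ℕ} (p : MvPolynomial (Fin n) ℂ)
    (hp : ∀ d ∈ p.support, k ≤ Finsupp.weight l d) :
    (k : ℕ∞) ≤ valuation l (p : MvPowerSeries (Fin n) ℂ) := by
  obtain ⟨q, hq⟩ : (MvPolynomial.X none ^ k : MvPolynomial (Option (Fin n)) ℂ) ∣
      MvPolynomial.aeval (fun i : Fin n =>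
        (MvPolynomial.X none ^ l i * MvPolynomial.X (some i) :
          MvPolynomial (Option (Fin n)) ℂ)) p := by
    rw [p.as_sum, map_sum]
    refine Finset.dvd_sum fun d hd => ?_
    rw [MvPolynomial.aeval_monomial]
    refine Dvd.dvd.mul_left ?_ _
    rw [Finsupp.prod_fintype _ _ (by simp)]
    simp only [mul_pow, Finset.prod_mul_distrib]
    refine Dvd.dvd.mul_right ?_ _
    rw [← Finset.prod_congr rfl fun i _ => pow_mul _ _ _, Finset.prod_pow_eq_pow_sum]
    refine pow_dvd_pow _ ((hp d hd).trans_eq ?_)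
    simp [Finsupp.weight_apply, Finsupp.sum_fintype, mul_comm]
  refine le_sSup ⟨k, rfl, q, isConvergent_coe q, ?_⟩
  rw [scale, MvPowerSeries.subst_coe]
  have := congrArg (MvPolynomial.coeToMvPowerSeries.algHom (σ := Option (Fin n)) (R := ℂ) ℂ) hq
  rw [MvPolynomial.comp_aeval_apply] at this
  simpa [MvPolynomial.coeToMvPowerSeries.algHom_apply, Function.comp_def] using this

end Valuation

/-! ### Taylor series in local parameters: existence and products. -/

section Taylor

open IsLocalRing

theorem IsLocalParameters.span_range {R : Type*} [CommRing R] [IsNoetherianRing R] {P : Ideal R}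
    [P.IsPrime] {n : ℕ} {T : Fin n → Localization.AtPrime P} (hT : IsLocalParameters P T) :
    Ideal.span (Set.range T) = maximalIdeal (Localization.AtPrime P) := by
  obtain ⟨hm, -, hs⟩ := hT
  have : IsNoetherianRing (Localization.AtPrime P) :=
    IsLocalization.isNoetherianRing P.primeCompl _ inferInstance
  have h := hs
  rw [show (Set.range fun i => (maximalIdeal (Localization.AtPrime P)).toCotangent ⟨T i, hm i⟩) =
    (maximalIdeal (Localization.AtPrime P)).toCotangent '' Set.range fun i => ⟨T i, hm i⟩ by
      rw [← Set.range_comp]; rfl, CotangentSpace.span_image_eq_top_iff] at h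
  have h2 := congrArg (Submodule.map (Submodule.subtype _)) h
  rw [Submodule.map_span, Submodule.map_top, Submodule.range_subtype, ← Set.range_comp] at h2
  exact h2

variable {R : Type*} [CommRing R] [Algebra ℂ R] {P : Ideal R} [P.IsPrime] {n : ℕ}
  {T : Fin n → Localization.AtPrime P}

theorem map_idealOfVars (T : Fin n → Localization.AtPrime P) :
    (MvPolynomial.idealOfVars (Fin n) ℂ).map (MvPolynomial.aeval T : _ →ₐ[ℂ] _) =
      Ideal.span (Set.range T) := by
  rw [MvPolynomial.idealOfVars, Ideal.map_span, ← Set.range_comp]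
  simp [Function.comp_def]

theorem aeval_mem_pow (hT : Ideal.span (Set.range T) = maximalIdeal (Localization.AtPrime P))
    {N : ℕ} {p : MvPolynomial (Fin n) ℂ} (hp : p ∈ MvPolynomial.idealOfVars (Fin n) ℂ ^ N) :
    MvPolynomial.aeval T p ∈ maximalIdeal (Localization.AtPrime P) ^ N := by
  rw [← hT, ← map_idealOfVars, ← Ideal.map_pow]
  exact Ideal.mem_map_of_mem _ hp

/-- The power `𝔪 ^ N` is generated by values of polynomials of order at least `N`; replacing a
coefficient by its residue in `ℂ` changes the sum only by an element of `𝔪 ^ (N + 1)`. -/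
theorem exists_sub_aeval_mem
    (hT : Ideal.span (Set.range T) = maximalIdeal (Localization.AtPrime P))
    (hres : ∀ f : Localization.AtPrime P, ∃ c : ℂ, f - algebraMap ℂ _ c ∈ maximalIdeal _)
    {N : ℕ} {f : Localization.AtPrime P} (hf : f ∈ maximalIdeal (Localization.AtPrime P) ^ N) :
    ∃ p ∈ MvPolynomial.idealOfVars (Fin n) ℂ ^ N,
      f - MvPolynomial.aeval T p ∈ maximalIdeal (Localization.AtPrime P) ^ (N + 1) := by
  have hf' := hf
  rw [← hT, ← map_idealOfVars, ← Ideal.map_pow] at hf'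
  refine Submodule.span_induction (p := fun f _ => ∃ p ∈ MvPolynomial.idealOfVars (Fin n) ℂ ^ N,
      f - MvPolynomial.aeval T p ∈ maximalIdeal (Localization.AtPrime P) ^ (N + 1))
    ?_ ?_ ?_ ?_ hf'
  · rintro _ ⟨p, hp, rfl⟩
    exact ⟨p, hp, by simp⟩
  · exact ⟨0, zero_mem _, by simp⟩
  · rintro x y - - ⟨p, hp, hxp⟩ ⟨q, hq, hyq⟩
    refine ⟨p + q, add_mem hp hq, ?_⟩
    rw [map_add, add_sub_add_comm]
    exact add_mem hxp hyq
  · rintro a x - ⟨p, hp, hxp⟩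
    obtain ⟨c, hc⟩ := hres a
    refine ⟨MvPolynomial.C c * p, Ideal.mul_mem_left _ _ hp, ?_⟩
    have h1 := Ideal.mul_mem_mul hc (aeval_mem_pow hT hp)
    rw [← pow_succ'] at h1
    rw [map_mul, ← MvPolynomial.algebraMap_eq, AlgHom.commutes, smul_eq_mul]
    convert add_mem (Ideal.mul_mem_left _ a hxp) h1 using 1
    ring

theorem exists_isTaylorSeries
    (hT : Ideal.span (Set.range T) = maximalIdeal (Localization.AtPrime P))
    (hres : ∀ f : Localization.AtPrime P, ∃ c : ℂ, f - algebraMap ℂ _ c ∈ maximalIdeal _)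
    (f : Localization.AtPrime P) : ∃ F, IsTaylorSeries P T f F := by
  choose! p hp hpf using fun N f => exists_sub_aeval_mem hT hres (N := N) (f := f)
  let rem : ℕ → Localization.AtPrime P :=
    fun N => Nat.rec f (fun N g => g - MvPolynomial.aeval T (p N g)) N
  have hrem : ∀ N, rem N ∈ maximalIdeal (Localization.AtPrime P) ^ N := by
    intro N
    induction N with
    | zero => simp
    | succ N ih => exact hpf N _ ih
  have hsum : ∀ N, f - MvPolynomial.aeval T (∑ j ∈ Finset.range N, p j (rem j)) = rem N := by
    intro N
    induction N with
    | zero => simp [rem]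
    | succ N ih =>
      rw [Finset.sum_range_succ, map_add, ← sub_sub, ih]
  -- The correction `p j` has no terms of degree below `j`, so only `j ≤ u.degree` can contribute to
  -- the coefficient at `u`.
  let F : MvPowerSeries (Fin n) ℂ :=
    fun u => ∑ j ∈ Finset.range (u.degree + 1), (p j (rem j)).coeff u
  refine ⟨F, fun N => ?_⟩
  have hF : ∑ j ∈ Finset.range N, p j (rem j) - MvPowerSeries.truncTotal N F ∈
      MvPolynomial.idealOfVars (Fin n) ℂ ^ N := by
    refine (MvPolynomial.mem_pow_idealOfVars_iff' _ _).2 fun d hd => ?_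
    rw [MvPolynomial.coeff_sub, MvPowerSeries.coeff_truncTotal _ hd, MvPolynomial.coeff_sum,
      sub_eq_zero]
    symm
    refine Finset.sum_subset (Finset.range_subset_range.2 hd) fun j _ hj => ?_
    exact (MvPolynomial.mem_pow_idealOfVars_iff' _ _).1 (hp j _ (hrem j)) d (by simpa using hj)
  have := add_mem (hrem N) (aeval_mem_pow hT hF)
  rw [← hsum N, map_sub, sub_add_sub_cancel] at this
  exact this

theorem IsTaylorSeries.mul
    (hT : Ideal.span (Set.range T) = maximalIdeal (Localization.AtPrime P))
    {f g : Localization.AtPrime P} {F G : MvPowerSeries (Fin n) ℂ}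
    (hF : IsTaylorSeries P T f F) (hG : IsTaylorSeries P T g G) :
    IsTaylorSeries P T (f * g) (F * G) := by
  intro N
  have h := aeval_mem_pow hT
    (MvPowerSeries.truncTotal_mul_sub_mul_truncTotal_mem_pow_idealOfVars (n := N) F G)
  rw [map_sub, map_mul (MvPolynomial.aeval T)] at h
  have h1 := Ideal.mul_mem_left _ g (hF N)
  have h2 := Ideal.mul_mem_left _ (MvPolynomial.aeval T (MvPowerSeries.truncTotal N F)) (hG N)
  convert sub_mem (add_mem h1 h2) h using 1
  ring

theorem isTaylorSeries_one : IsTaylorSeries P T 1 1 := by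
  intro N
  rcases eq_or_ne N 0 with rfl | hN
  · simp
  · simp [MvPowerSeries.truncTotal_one hN]

theorem IsTaylorSeries.pow
    (hT : Ideal.span (Set.range T) = maximalIdeal (Localization.AtPrime P))
    {f : Localization.AtPrime P} {F : MvPowerSeries (Fin n) ℂ}
    (hF : IsTaylorSeries P T f F) (k : ℕ) : IsTaylorSeries P T (f ^ k) (F ^ k) := by
  induction k with
  | zero => simpa using isTaylorSeries_one
  | succ k ih => rw [pow_succ, pow_succ]; exact ih.mul hT hF

theorem IsTaylorSeries.prod
    (hT : Ideal.span (Set.range T) = maximalIdeal (Localization.AtPrime P))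
    {ι : Type*} (s : Finset ι) {f : ι → Localization.AtPrime P}
    {F : ι → MvPowerSeries (Fin n) ℂ} (hF : ∀ i, IsTaylorSeries P T (f i) (F i)) :
    IsTaylorSeries P T (∏ i ∈ s, f i) (∏ i ∈ s, F i) := by
  classical
  induction s using Finset.induction_on with
  | empty => simpa using isTaylorSeries_one
  | insert i s hi ih => rw [Finset.prod_insert hi, Finset.prod_insert hi]; exact (hF i).mul hT ih

end Taylor

/-! ### The local ring at the origin and changes of parameters. -/

section Origin

open IsLocalRing

variable (n : ℕ)

/-- The local ring of affine space at the origin. -/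
abbrev OriginRing : Type :=
  Localization.AtPrime (MvPolynomial.vanishingIdeal ℂ {(0 : Fin n → ℂ)})

theorem mem_origin_iff (p : MvPolynomial (Fin n) ℂ) :
    p ∈ MvPolynomial.vanishingIdeal ℂ {(0 : Fin n → ℂ)} ↔ MvPolynomial.constantCoeff p = 0 := by
  rw [MvPolynomial.mem_vanishingIdeal_singleton_iff, MvPolynomial.aeval_zero]
  simp

/-- The expansion of germs at the origin as power series in the standard coordinates. -/
def expansion : OriginRing n →ₐ[ℂ] MvPowerSeries (Fin n) ℂ :=
  IsLocalization.liftAlgHom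
    (M := (MvPolynomial.vanishingIdeal ℂ {(0 : Fin n → ℂ)}).primeCompl)
    (f := MvPolynomial.coeToMvPowerSeries.algHom ℂ) (by
      rintro ⟨p, hp⟩
      rw [MvPowerSeries.isUnit_iff_constantCoeff, isUnit_iff_ne_zero]
      simp [MvPolynomial.coeToMvPowerSeries.algHom_apply]
      exact fun h => hp ((mem_origin_iff n p).2 h))

variable {n}

theorem expansion_algebraMap (p : MvPolynomial (Fin n) ℂ) :
    expansion n (algebraMap _ _ p) = p := by
  simp [expansion, MvPolynomial.coeToMvPowerSeries.algHom_apply]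

theorem mem_maximalIdeal_iff (f : OriginRing n) :
    f ∈ maximalIdeal (OriginRing n) ↔ (expansion n f).constantCoeff = 0 := by
  rw [mem_maximalIdeal, mem_nonunits_iff, not_iff_comm]
  constructor
  · intro h
    obtain ⟨⟨p, s⟩, hs⟩ := IsLocalization.surj
      (MvPolynomial.vanishingIdeal ℂ {(0 : Fin n → ℂ)}).primeCompl f
    have h1 := congrArg (fun x => (expansion n x).constantCoeff) hs
    simp only [map_mul, expansion_algebraMap] at h1
    have hp : p ∈ (MvPolynomial.vanishingIdeal ℂ {(0 : Fin n → ℂ)}).primeCompl := by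
      intro hp
      replace hp := (mem_origin_iff n p).1 hp
      have hs' : MvPolynomial.constantCoeff s.1 ≠ 0 := fun h' => s.2 ((mem_origin_iff n _).2 h')
      rw [show (p : MvPowerSeries (Fin n) ℂ).constantCoeff = MvPolynomial.constantCoeff p from rfl,
        hp] at h1
      exact (mul_ne_zero h hs') h1
    have hu := IsLocalization.map_units (OriginRing n) ⟨p, hp⟩
    exact isUnit_of_mul_isUnit_left (hs ▸ hu)
  · intro h h0
    have := (h.map (expansion n)).map (MvPowerSeries.constantCoeff (σ := Fin n) (R := ℂ))
    simp [h0] at this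

theorem exists_sub_algebraMap_mem (f : OriginRing n) :
    ∃ c : ℂ, f - algebraMap ℂ _ c ∈ maximalIdeal (OriginRing n) := by
  refine ⟨(expansion n f).constantCoeff, ?_⟩
  rw [mem_maximalIdeal_iff, map_sub, AlgHom.commutes]
  simp [MvPowerSeries.algebraMap_apply]

theorem le_order_expansion {N : ℕ} {f : OriginRing n} (hf : f ∈ maximalIdeal (OriginRing n) ^ N) :
    (N : ℕ∞) ≤ (expansion n f).order := by
  induction N generalizing f with
  | zero => simp
  | succ N ih =>
    rw [pow_succ] at hf
    refine Submodule.mul_induction_on hf ?_ ?_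
    · intro a ha b hb
      rw [map_mul]
      refine le_trans ?_ MvPowerSeries.le_order_mul
      push_cast
      exact add_le_add (ih ha)
        (MvPowerSeries.one_le_order_iff_constCoeff_eq_zero.2 ((mem_maximalIdeal_iff b).1 hb))
    · intro a b ha hb
      rw [map_add]
      exact (le_min ha hb).trans MvPowerSeries.min_order_le_add

/-- The standard coordinates at the origin. -/
def coordinates (i : Fin n) : OriginRing n :=
  algebraMap (MvPolynomial (Fin n) ℂ) _ (MvPolynomial.X i)

theorem expansion_coordinates (i : Fin n) : expansion n (coordinates i) = MvPowerSeries.X i := by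
  rw [coordinates, expansion_algebraMap, MvPolynomial.coe_X]

theorem aeval_coordinates (p : MvPolynomial (Fin n) ℂ) :
    MvPolynomial.aeval (coordinates (n := n)) p = algebraMap _ (OriginRing n) p := by
  have : MvPolynomial.aeval (coordinates (n := n)) = IsScalarTower.toAlgHom ℂ _ (OriginRing n) := by
    ext i; simp [coordinates]
  rw [this]; rfl

theorem isTaylorSeries_coordinates {f : OriginRing n} {F : MvPowerSeries (Fin n) ℂ}
    (hF : IsTaylorSeries _ coordinates f F) : F = expansion n f := by
  ext d
  have h := le_order_expansion (hF (d.degree + 1))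
  have h1 := MvPowerSeries.coeff_of_lt_order (d := d)
    (lt_of_lt_of_le (by exact_mod_cast Nat.lt_succ_self _) h)
  rw [map_sub, aeval_coordinates, expansion_algebraMap, map_sub, MvPolynomial.coeff_coe,
    MvPowerSeries.coeff_truncTotal _ (Nat.lt_succ_self _), sub_eq_zero] at h1
  exact h1.symm

theorem span_coordinates :
    Ideal.span (Set.range (coordinates (n := n))) = maximalIdeal (OriginRing n) := by
  rw [← IsLocalization.AtPrime.map_eq_maximalIdeal
    (MvPolynomial.vanishingIdeal ℂ {(0 : Fin n → ℂ)}) (OriginRing n)]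
  have : MvPolynomial.vanishingIdeal ℂ {(0 : Fin n → ℂ)} = MvPolynomial.idealOfVars (Fin n) ℂ := by
    ext p
    rw [mem_origin_iff, ← pow_one (MvPolynomial.idealOfVars (Fin n) ℂ),
      MvPolynomial.mem_pow_idealOfVars_iff']
    constructor
    · intro h d hd
      obtain rfl : d = 0 := (Finsupp.degree_eq_zero_iff d).1 (by omega)
      exact h
    · intro h
      exact h 0 (by simp)
  refine Eq.trans ?_ (congrArg (Ideal.map (algebraMap _ (OriginRing n))) this).symm
  rw [MvPolynomial.idealOfVars, Ideal.map_span, ← Set.range_comp]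
  rfl

theorem isLocalParameters_coordinates :
    IsLocalParameters (MvPolynomial.vanishingIdeal ℂ {(0 : Fin n → ℂ)}) coordinates := by
  have hm : ∀ i, coordinates i ∈ maximalIdeal (OriginRing n) := fun i => by
    rw [← span_coordinates]; exact Ideal.subset_span ⟨i, rfl⟩
  have : IsNoetherianRing (OriginRing n) :=
    IsLocalization.isNoetherianRing
      (MvPolynomial.vanishingIdeal ℂ {(0 : Fin n → ℂ)}).primeCompl _ inferInstance
  refine ⟨hm, ?_, ?_⟩
  · rw [Fintype.linearIndependent_iff]
    intro g hg j
    choose c hc using fun i => residue_surjective (g i)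
    have h0 : (maximalIdeal (OriginRing n)).toCotangent (∑ i, c i • ⟨coordinates i, hm i⟩) = 0 := by
      rw [map_sum, ← hg]
      refine Finset.sum_congr rfl fun i _ => ?_
      rw [map_smul, ← hc i]
      rfl
    -- The lifted relation lies in `𝔪 ^ 2`, so its expansion has no linear term; the coefficient of
    -- `X j` is the constant term of `c j`.
    rw [Ideal.toCotangent_eq_zero] at h0
    have h1 := le_order_expansion h0
    rw [← hc j, residue_eq_zero_iff, mem_maximalIdeal_iff]
    have h2 := MvPowerSeries.coeff_of_lt_order (d := Finsupp.single j 1)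
      (lt_of_lt_of_le (by simp) h1)
    rw [← h2]
    simp [expansion_coordinates, coeff_single_mul, MvPowerSeries.coeff_X,
      Finsupp.single_left_inj]
  · rw [show (Set.range fun i => (maximalIdeal (OriginRing n)).toCotangent
        ⟨coordinates i, hm i⟩) = (maximalIdeal (OriginRing n)).toCotangent ''
          Set.range fun i => ⟨coordinates i, hm i⟩ by
      rw [← Set.range_comp]; rfl, CotangentSpace.span_image_eq_top_iff]
    apply Submodule.map_injective_of_injective (Submodule.subtype_injective _)
    rw [Submodule.map_span, Submodule.map_top, Submodule.range_subtype, ← Set.range_comp]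
    exact span_coordinates

theorem le_order_coordinates (l : Fin n → ℕ) (a : Ideal (MvPolynomial (Fin n) ℂ)) {k : ℕ}
    (h : ∀ p ∈ a, ∀ d ∈ p.support, k ≤ Finsupp.weight l d) :
    (k : ℕ∞) ≤ order (MvPolynomial.vanishingIdeal ℂ {(0 : Fin n → ℂ)}) coordinates l a := by
  refine le_sInf ?_
  rintro _ ⟨p, hp, F, hF, rfl⟩
  rw [isTaylorSeries_coordinates hF, expansion_algebraMap]
  exact le_valuation_coe l p (h p hp)

/-- The linear part of the expansion of the coordinates in local parameters is invertible. -/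
theorem det_linear_part_ne_zero {T : Fin n → OriginRing n}
    (hT : Ideal.span (Set.range T) = maximalIdeal (OriginRing n))
    {F : Fin n → MvPowerSeries (Fin n) ℂ} (hF : ∀ i, IsTaylorSeries _ T (coordinates i) (F i)) :
    (Matrix.of fun i j => (F i).coeff (Finsupp.single j 1)).det ≠ 0 := by
  classical
  -- Chain rule: the inverse is the linear part of `T` expanded in the standard coordinates.
  refine Matrix.det_ne_zero_of_right_inverse
    (B := Matrix.of fun j k => (expansion n (T j)).coeff (Finsupp.single k 1)) ?_
  ext i k
  have hF2 : MvPowerSeries.truncTotal 2 (F i) - (MvPolynomial.C (F i).constantCoeff +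
      ∑ j, MvPolynomial.C ((F i).coeff (Finsupp.single j 1)) * MvPolynomial.X j) ∈
      MvPolynomial.idealOfVars (Fin n) ℂ ^ 2 := by
    refine (MvPolynomial.mem_pow_idealOfVars_iff' _ _).2 fun d hd => ?_
    rw [MvPolynomial.coeff_sub, MvPowerSeries.coeff_truncTotal _ hd]
    rcases Nat.lt_succ_iff_lt_or_eq.1 hd with h | h
    · obtain rfl : d = 0 := (Finsupp.degree_eq_zero_iff d).1 (by omega)
      simp [MvPolynomial.coeff_sum]
    · obtain ⟨j, rfl⟩ : ∃ j, d = Finsupp.single j 1 := by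
        simpa [eq_comm] using Finsupp.range_single_one.ge h
      simp [MvPolynomial.coeff_sum, MvPolynomial.coeff_C_mul, MvPolynomial.coeff_X,
        MvPolynomial.coeff_C, Finsupp.single_left_inj]
      exact fun h0 => absurd h0.symm (by simp)
  have h := le_order_expansion (add_mem (hF i 2) (aeval_mem_pow hT hF2))
  have h1 := MvPowerSeries.coeff_of_lt_order (d := Finsupp.single k 1)
      (lt_of_lt_of_le (by simp) h)
  rw [map_sub, sub_add_sub_cancel, map_sub, expansion_coordinates, map_sub, sub_eq_zero] at h1
  have hT0 : ∀ j, (expansion n (T j)).constantCoeff = 0 := fun j =>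
    (mem_maximalIdeal_iff _).1 (hT ▸ Ideal.subset_span ⟨j, rfl⟩)
  rw [map_add, map_sum, map_add, map_sum, map_add, map_sum] at h1
  simp only [map_mul, MvPolynomial.aeval_X, MvPolynomial.aeval_C, AlgHom.commutes,
    MvPowerSeries.algebraMap_apply, coeff_single_mul, hT0] at h1
  simp only [Matrix.mul_apply, Matrix.of_apply, Matrix.one_apply]
  simpa [MvPowerSeries.coeff_C, MvPowerSeries.coeff_X, Finsupp.single_left_inj, eq_comm] using h1.symm

/-- A nonzero determinant has a nonzero term in its Leibniz expansion, which matches each coordinate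
with a parameter occurring linearly in its series. The weighted order of that series is then at most
the weight of the parameter. -/
theorem exists_perm_order_le {T : Fin n → OriginRing n} (hT : IsLocalParameters _ T)
    (l : Fin n → ℕ) : ∃ τ : Equiv.Perm (Fin n), ∀ (a : Ideal (MvPolynomial (Fin n) ℂ)) (u),
      MvPolynomial.monomial u 1 ∈ a → order _ T l a ≤ (Finsupp.weight (l ∘ τ) u : ℕ) := by
  classical
  have hs := hT.span_range
  choose F hF using fun i => exists_isTaylorSeries hs exists_sub_algebraMap_mem (coordinates i)
  have hdet := det_linear_part_ne_zero hs hF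
  rw [Matrix.det_apply'] at hdet
  obtain ⟨τ, -, hτ⟩ := Finset.exists_ne_zero_of_sum_ne_zero hdet
  have hτ' := fun i => Finset.prod_ne_zero_iff.1 (right_ne_zero_of_mul hτ) i (Finset.mem_univ i)
  -- The nonzero entries sit at `(τ i, i)`, so coordinate `i` is matched with parameter `τ⁻¹ i`.
  refine ⟨τ⁻¹, fun a u hu => ?_⟩
  have hmon : algebraMap _ (OriginRing n) (MvPolynomial.monomial u (1 : ℂ)) =
      ∏ i, coordinates i ^ u i := by
    rw [← aeval_coordinates, MvPolynomial.aeval_monomial, map_one, one_mul,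
      Finsupp.prod_fintype _ _ (by simp)]
  have hprod : IsTaylorSeries _ T (algebraMap _ (OriginRing n) (MvPolynomial.monomial u (1 : ℂ)))
      (∏ i, F i ^ u i) := by
    rw [hmon]
    exact IsTaylorSeries.prod hs _ fun i => (hF i).pow hs _
  have hle : order _ T l a ≤ valuation l (∏ i, F i ^ u i) := sInf_le ⟨_, hu, _, hprod, rfl⟩
  refine hle.trans ((valuation_le_weightedOrder l _).trans ?_)
  have hpow : ∀ (G : MvPowerSeries (Fin n) ℂ) (k : ℕ),
      (G ^ k).weightedOrder l = k * G.weightedOrder l := by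
    intro G k
    induction k with
    | zero => simp [MvPowerSeries.weightedOrder_one]
    | succ k ih => rw [pow_succ, weightedOrder_mul, ih]; push_cast; ring
  have hsum : ∀ (s : Finset (Fin n)) (G : Fin n → MvPowerSeries (Fin n) ℂ),
      (∏ i ∈ s, G i).weightedOrder l = ∑ i ∈ s, (G i).weightedOrder l := by
    intro s G
    induction s using Finset.induction_on with
    | empty => simp [MvPowerSeries.weightedOrder_one]
    | insert i s hi ih => rw [Finset.prod_insert hi, weightedOrder_mul, ih, Finset.sum_insert hi]
  rw [hsum, Finsupp.weight_apply, Finsupp.sum_fintype _ _ (by simp)]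
  push_cast
  refine Finset.sum_le_sum fun i _ => ?_
  rw [hpow]
  simp only [smul_eq_mul]
  push_cast
  gcongr
  have := hτ' (τ⁻¹ i)
  rw [Matrix.of_apply, show τ (τ⁻¹ i) = i from τ.apply_symm_apply i] at this
  simpa [Finsupp.weight_single] using MvPowerSeries.weightedOrder_le l this

end Origin


/-! ### Integrability: necessary and sufficient conditions. -/

open MeasureTheory

theorem norm_eval_le {n : ℕ} (p : MvPolynomial (Fin n) ℂ) {l : Fin n → ℕ} {k : ℕ}
    (hk : ∀ d ∈ p.support, k ≤ Finsupp.weight l d) {t : ℝ} (ht0 : 0 ≤ t) (ht1 : t ≤ 1)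
    {z : Fin n → ℂ} (hz : ∀ i, ‖z i‖ ≤ t ^ l i) :
    ‖MvPolynomial.eval z p‖ ≤ (∑ d ∈ p.support, ‖p.coeff d‖) * t ^ k := by
  rw [MvPolynomial.eval_eq', Finset.sum_mul]
  refine (norm_sum_le _ _).trans (Finset.sum_le_sum fun d hd => ?_)
  rw [norm_mul, norm_prod]
  gcongr
  calc ∏ i, ‖z i ^ d i‖ ≤ ∏ i, t ^ (l i * d i) := by
        refine Finset.prod_le_prod (fun _ _ => norm_nonneg _) fun i _ => ?_
        rw [norm_pow, pow_mul]
        gcongr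
        exact hz i
    _ = t ^ Finsupp.weight l d := by
        rw [Finset.prod_pow_eq_pow_sum]
        simp [Finsupp.weight_apply, Finsupp.sum_fintype, mul_comm]
    _ ≤ t ^ k := pow_le_pow_of_le_one ht0 ht1 (hk d hd)

/-- On the polydisc of radii `ε * t ^ l i` the integrand is at least a constant times `t ^ (-2 * k *
s)`, while the volume is a constant times `t ^ (2 * ∑ l i)`. Finiteness as `t → 0` forces the
inequality. -/
theorem mul_le_sum_of_lintegral_lt_top {n r : ℕ} (f : Fin r → MvPolynomial (Fin n) ℂ)
    {s : ℝ} (hs : 0 < s) {V : Set (Fin n → ℂ)} (hV : V ∈ 𝓝 0)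
    (hfin : ∫⁻ z in V, 1 / (ENNReal.ofReal (∑ i, ‖MvPolynomial.eval z (f i)‖ ^ 2)) ^ s < ∞)
    {l : Fin n → ℕ} {k : ℕ} (hk : ∀ i, ∀ d ∈ (f i).support, k ≤ Finsupp.weight l d) :
    s * k ≤ ∑ i, (l i : ℝ) := by
  obtain ⟨ε₀, hε₀, hball⟩ := Metric.mem_nhds_iff.1 hV
  obtain ⟨ε, hε, hε1, hεV⟩ : ∃ ε : ℝ, 0 < ε ∧ ε ≤ 1 ∧ Metric.ball 0 ε ⊆ V :=
    ⟨min ε₀ 1, by positivity, min_le_right _ _,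
      (Metric.ball_subset_ball (min_le_left _ _)).trans hball⟩
  set M := ∫⁻ z in V, 1 / (ENNReal.ofReal (∑ i, ‖MvPolynomial.eval z (f i)‖ ^ 2)) ^ s with hM
  -- The summand `1` keeps `C` positive even if all `f i` vanish.
  set C : ℝ := 1 + ∑ i, (∑ d ∈ (f i).support, ‖(f i).coeff d‖) ^ 2 with hC
  have hC0 : 0 < C := by positivity
  set D : ℝ := ε ^ (2 * n) * Real.pi ^ n with hD
  have hD0 : 0 < D := by positivity
  have key : ∀ t : ℝ, 0 < t → t ≤ 1 →
      (C * t ^ (2 * k)) ^ (-s) * (D * t ^ (2 * ∑ i, l i)) ≤ M.toReal := by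
    intro t ht0 ht1
    set S : Set (Fin n → ℂ) := Set.univ.pi fun i => Metric.ball 0 (ε * t ^ l i) with hS
    have hz : ∀ z ∈ S, ∀ i, ‖z i‖ < ε * t ^ l i := fun z hz i => by
      simpa using hz i (Set.mem_univ i)
    have hSV : S ⊆ V := by
      intro z hzS
      refine hεV ?_
      rw [mem_ball_zero_iff, pi_norm_lt_iff hε]
      intro i
      exact (hz z hzS i).trans_le (mul_le_of_le_one_right hε.le (pow_le_one₀ ht0.le ht1))
    have hSm : MeasurableSet S := MeasurableSet.univ_pi fun _ => measurableSet_ball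
    have hvol : volume S = ENNReal.ofReal (D * t ^ (2 * ∑ i, l i)) := by
      rw [hS, volume_pi_pi]
      simp only [Complex.volume_ball]
      have : ∀ i, ENNReal.ofReal (ε * t ^ l i) ^ 2 * (NNReal.pi : ℝ≥0∞) =
          ENNReal.ofReal ((ε * t ^ l i) ^ 2 * Real.pi) := by
        intro i
        rw [ENNReal.ofReal_mul (p := (ε * t ^ l i) ^ 2) (by positivity),
          ENNReal.ofReal_pow (p := ε * t ^ l i) (by positivity)]
        rw [← NNReal.coe_real_pi, ENNReal.ofReal_coe_nnreal]
      simp only [this]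
      rw [← ENNReal.ofReal_prod_of_nonneg fun _ _ => by positivity]
      congr 1
      simp only [mul_pow, Finset.prod_mul_distrib, Finset.prod_const, Finset.card_univ,
        Fintype.card_fin, ← pow_mul]
      rw [Finset.prod_pow_eq_pow_sum, hD, ← Finset.sum_mul, mul_comm (∑ i, l i) 2]
      ring
    have hF : ∀ z ∈ S, ENNReal.ofReal ((C * t ^ (2 * k)) ^ (-s)) ≤
        1 / (ENNReal.ofReal (∑ i, ‖MvPolynomial.eval z (f i)‖ ^ 2)) ^ s := by
      intro z hzS
      rw [← ENNReal.ofReal_rpow_of_pos (by positivity), ENNReal.rpow_neg, one_div]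
      gcongr
      have : ∀ i, ‖MvPolynomial.eval z (f i)‖ ^ 2 ≤
          (∑ d ∈ (f i).support, ‖(f i).coeff d‖) ^ 2 * t ^ (2 * k) := by
        intro i
        rw [mul_comm 2 k, pow_mul t, ← mul_pow]
        gcongr
        refine norm_eval_le (f i) (hk i) ht0.le ht1 fun i => (hz z hzS i).le.trans ?_
        exact mul_le_of_le_one_left (by positivity) hε1
      refine (Finset.sum_le_sum fun i _ => this i).trans ?_
      rw [← Finset.sum_mul]
      gcongr
      simp [hC]
    have h1 : ENNReal.ofReal ((C * t ^ (2 * k)) ^ (-s)) * volume S ≤ M := by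
      rw [← setLIntegral_const]
      exact (setLIntegral_mono' hSm hF).trans (lintegral_mono_set hSV)
    rw [hvol, ← ENNReal.ofReal_mul (by positivity)] at h1
    exact (ENNReal.ofReal_le_iff_le_toReal hfin.ne).1 h1
  by_contra! hlt
  have hlim := tendsto_rpow_atTop (y := 2 * (s * k - ∑ i, (l i : ℝ))) (by linarith)
  obtain ⟨x, hx, hx1⟩ := ((hlim.eventually_gt_atTop (M.toReal / (C ^ (-s) * D))).and
    (Filter.eventually_ge_atTop 1)).exists
  have hx0 : 0 < x := by linarith
  have h2 := key x⁻¹ (by positivity) (inv_le_one_of_one_le₀ hx1)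
  rw [div_lt_iff₀ (by positivity)] at hx
  refine absurd (h2.trans_lt hx) (not_lt.2 (le_of_eq ?_))
  have hpow : ∀ m : ℕ, x⁻¹ ^ m = x ^ (-(m : ℝ)) := fun m => by
    rw [Real.rpow_neg hx0.le, Real.rpow_natCast, inv_pow]
  have hexp : x ^ (2 * (s * k - ∑ i, (l i : ℝ))) =
      x ^ (-((2 * k : ℕ) : ℝ) * -s) * x ^ (-((2 * ∑ i, l i : ℕ) : ℝ)) := by
    rw [← Real.rpow_add hx0]
    congr 1
    push_cast
    ring
  rw [hpow, hpow, Real.mul_rpow hC0.le (by positivity), ← Real.rpow_mul hx0.le, hexp]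
  ring

/-- If no such combination exists, the open orthant `A` misses the scaled convex hull of `U`. A
separating functional is a real weight violating the hypothesis; the gap `s < s'` absorbs the
rounding to integers. -/
theorem exists_convex_weights {n : ℕ} (U : Finset (Fin n →₀ ℕ)) (hU : U.Nonempty) {s s' : ℝ}
    (hs : 0 < s) (hss' : s < s')
    (h : ∀ l : Fin n → ℕ, l ≠ 0 → ∀ k : ℕ, (∀ u ∈ U, k ≤ Finsupp.weight l u) →
      s' * k ≤ ∑ i, (l i : ℝ)) :
    ∃ c : U → ℝ, (∀ u, 0 ≤ c u) ∧ ∑ u, c u = 1 ∧ ∀ i, s * ∑ u, c u * (u.1 i : ℝ) < 1 := by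
  classical
  let φ : (U → ℝ) → Fin n → ℝ := fun c i => s * ∑ u, c u * (u.1 i : ℝ)
  have hφ : IsLinearMap ℝ φ := by
    constructor
    · intro c d; ext i
      simp [φ, add_mul, Finset.sum_add_distrib, mul_add]
    · intro a c; ext i
      simp only [φ, Pi.smul_apply, smul_eq_mul, mul_assoc, ← Finset.mul_sum]
      ring
  set A : Set (Fin n → ℝ) := Set.univ.pi fun _ => Set.Iio 1 with hA
  by_cases hdisj : Disjoint A (φ '' stdSimplex ℝ U)
  swap
  · obtain ⟨_, hw, c, hc, rfl⟩ := Set.not_disjoint_iff.1 hdisj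
    exact ⟨c, hc.1, hc.2, fun i => hw i (Set.mem_univ i)⟩
  exfalso
  obtain ⟨g, ρ, hgA, hgB⟩ := geometric_hahn_banach_open
    (convex_pi fun i _ => convex_Iio (1 : ℝ)) (isOpen_set_pi Set.finite_univ fun _ _ => isOpen_Iio)
    ((convex_stdSimplex ℝ U).is_linear_image hφ) hdisj
  set lam : Fin n → ℝ := fun i => g (Pi.single i 1) with hlam
  have hg : ∀ w : Fin n → ℝ, g w = ∑ i, w i * lam i := by
    intro w
    conv_lhs => rw [pi_eq_sum_univ' w]
    simp [map_sum, hlam]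
  have hρ : 0 < ρ := by
    have := hgA 0 (by simp)
    simpa using this
  -- The set `A` is unbounded below in each coordinate, so a negative `lam i` would let the
  -- functional reach `ρ` on `A`.
  have hlam0 : ∀ i, 0 ≤ lam i := by
    intro i
    by_contra! hi
    have := hgA (Pi.single i (ρ / lam i)) (by
      intro j _
      simp only [Set.mem_Iio, Pi.single_apply]
      split_ifs
      · exact (div_neg_of_pos_of_neg hρ hi).trans one_pos
      · exact one_pos)
    rw [hg, Finset.sum_eq_single i (by simp +contextual) (by simp)] at this
    simp [hi.ne] at this
  have hsum : ∑ i, lam i ≤ ρ := by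
    by_contra! hlt
    have hpos := hρ.trans hlt
    have := hgA (fun _ => ρ / ∑ i, lam i) fun _ _ => (div_lt_one hpos).2 hlt
    rw [hg, ← Finset.mul_sum, div_mul_cancel₀ _ hpos.ne'] at this
    exact lt_irrefl _ this
  have hu : ∀ u ∈ U, ρ ≤ s * ∑ i, (u i : ℝ) * lam i := by
    intro u huU
    have := hgB _ ⟨Pi.single ⟨u, huU⟩ 1, single_mem_stdSimplex ℝ _, rfl⟩
    rw [hg] at this
    refine this.trans_eq ?_
    simp [φ, Pi.single_apply, Finset.mul_sum, mul_assoc]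
  -- Rounding up `N * lam i` adds at most `n` to the total weight; this `N` makes the gain `N * ρ *
  -- (s' - s) / s` exceed `n`.
  obtain ⟨N, hN⟩ := exists_nat_gt (n * s / (ρ * (s' - s)))
  have hN0 : (0 : ℝ) < N := lt_of_le_of_lt (by
    have := sub_pos.2 hss'
    positivity) hN
  set l : Fin n → ℕ := fun i => ⌈N * lam i⌉₊ with hl
  have hw : ∀ u ∈ U, (⌈N * (ρ / s)⌉₊ : ℕ) ≤ Finsupp.weight l u := by
    intro u huU
    refine Nat.ceil_le.2 ?_
    rw [Finsupp.weight_apply, Finsupp.sum_fintype _ _ (by simp)]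
    have h1 : ρ / s ≤ ∑ i, (u i : ℝ) * lam i := by
      rw [div_le_iff₀' hs]; exact hu u huU
    calc (N : ℝ) * (ρ / s) ≤ N * ∑ i, (u i : ℝ) * lam i := by gcongr
      _ = ∑ i, (u i : ℝ) * (N * lam i) := by
        rw [Finset.mul_sum]; exact Finset.sum_congr rfl fun _ _ => by ring
      _ ≤ ∑ i, (u i : ℝ) * l i := by
        gcongr with i
        exact Nat.le_ceil _
      _ = _ := by push_cast; simp
  have hl0 : l ≠ 0 := by
    intro hl0
    obtain ⟨u, huU⟩ := hU
    have := hw u huU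
    have hpos : 0 < ⌈N * (ρ / s)⌉₊ := Nat.ceil_pos.2 (by positivity)
    rw [hl0, Finsupp.weight_apply] at this
    simp only [Pi.zero_apply, smul_zero, Finsupp.sum_fun_zero] at this
    omega
  have h1 := h l hl0 _ hw
  have h2 : ∑ i, (l i : ℝ) ≤ N * ρ + n := by
    calc ∑ i, (l i : ℝ) ≤ ∑ i, (N * lam i + 1) :=
          Finset.sum_le_sum fun i _ => (Nat.ceil_lt_add_one (by have := hlam0 i; positivity)).le
      _ = N * ∑ i, lam i + n := by
          rw [Finset.sum_add_distrib, Finset.mul_sum]; simp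
      _ ≤ _ := by gcongr
  have h3 : s' * (N * (ρ / s)) ≤ N * ρ + n :=
    (mul_le_mul_of_nonneg_left (Nat.le_ceil _) (hs.trans hss').le).trans (h1.trans h2)
  rw [div_lt_iff₀ (mul_pos hρ (sub_pos.2 hss'))] at hN
  have h4 : s' * (N * (ρ / s)) * s = s' * N * ρ := by field_simp
  nlinarith [mul_le_mul_of_nonneg_right h3 hs.le]

/-- The unit ball of the sup norm is a product of discs, so Fubini reduces to one factor; the bound
`2` is the real dimension of `ℂ`. -/
theorem integrableOn_prod_norm_rpow {n : ℕ} {b : Fin n → ℝ} (hb : ∀ i, b i < 2) :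
    IntegrableOn (fun z : Fin n → ℂ => ∏ i, ‖z i‖ ^ (-b i)) (Metric.ball 0 1) := by
  have hball : Metric.ball (0 : Fin n → ℂ) 1 = Set.univ.pi fun _ => Metric.ball 0 1 := by
    ext z
    simp [pi_norm_lt_iff]
  rw [IntegrableOn, hball, volume_pi, Measure.restrict_pi_pi]
  refine Integrable.fintype_prod (f := fun i (x : ℂ) => ‖x‖ ^ (-b i)) fun i => ?_
  refine integrableOn_ball_of_norm_le_rpow (C := 1) (α := b i) (by simp) (by simpa using hb i) ?_ ?_
  · filter_upwards with x
    rw [Real.norm_of_nonneg (by positivity), one_mul]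
  · exact (measurable_norm.pow_const _).aestronglyMeasurable

theorem lintegral_lt_top_of_convex_weights {n r : ℕ} (f : Fin r → MvPolynomial (Fin n) ℂ)
    (U : Finset (Fin n →₀ ℕ)) (hU : ∀ u ∈ U, MvPolynomial.monomial u 1 ∈ Ideal.span (Set.range f))
    {s : ℝ} (hs : 0 < s) (c : U → ℝ) (hc0 : ∀ u, 0 ≤ c u) (hc1 : ∑ u, c u = 1)
    (hc : ∀ i, s * ∑ u, c u * (u.1 i : ℝ) < 1) :
    ∫⁻ z in Metric.ball 0 1,
      1 / (ENNReal.ofReal (∑ i, ‖MvPolynomial.eval z (f i)‖ ^ 2)) ^ s < ∞ := by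
  -- Write the monomial as a combination of the `f i`, apply Cauchy–Schwarz, and bound the cofactors
  -- on the compact closed ball.
  have hbound : ∀ u : U, ∃ B : ℝ, 0 ≤ B ∧ ∀ z ∈ Metric.ball (0 : Fin n → ℂ) 1,
      (∏ i, ‖z i‖ ^ u.1 i) ^ 2 ≤ B * ∑ i, ‖MvPolynomial.eval z (f i)‖ ^ 2 := by
    intro u
    obtain ⟨g, hg⟩ := (Ideal.mem_span_range_iff_exists_fun).1 (hU u.1 u.2)
    obtain ⟨B, hB⟩ := (isCompact_closedBall (0 : Fin n → ℂ) 1).exists_bound_of_continuousOn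
      (f := fun z => ∑ i, ‖MvPolynomial.eval z (g i)‖ ^ 2)
      (continuous_finsetSum _ fun i _ =>
        ((MvPolynomial.continuous_eval (g i)).norm.pow 2)).continuousOn
    refine ⟨max B 0, le_max_right _ _, fun z hz => ?_⟩
    have h1 : ∏ i, ‖z i‖ ^ u.1 i = ‖∑ i, MvPolynomial.eval z (g i) * MvPolynomial.eval z (f i)‖ := by
      simp only [← map_mul, ← map_sum]
      rw [hg, MvPolynomial.eval_monomial, one_mul, Finsupp.prod_fintype _ _ (by simp), norm_prod]
      simp
    have h2 : ‖∑ i, MvPolynomial.eval z (g i) * MvPolynomial.eval z (f i)‖ ≤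
        ∑ i, ‖MvPolynomial.eval z (g i)‖ * ‖MvPolynomial.eval z (f i)‖ :=
      (norm_sum_le _ _).trans_eq (by simp)
    rw [h1]
    calc _ ≤ (∑ i, ‖MvPolynomial.eval z (g i)‖ * ‖MvPolynomial.eval z (f i)‖) ^ 2 := by gcongr
      _ ≤ (∑ i, ‖MvPolynomial.eval z (g i)‖ ^ 2) * ∑ i, ‖MvPolynomial.eval z (f i)‖ ^ 2 :=
        Finset.sum_mul_sq_le_sq_mul_sq _ _ _
      _ ≤ _ := by
        gcongr
        exact (le_abs_self _).trans ((hB z (Metric.ball_subset_closedBall hz)).trans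
          (le_max_left _ _))
  choose B hB0 hB using hbound
  set C : ℝ := 1 + ∑ u, c u * B u with hC
  have hC0 : 0 < C := by
    have : 0 ≤ ∑ u, c u * B u := Finset.sum_nonneg fun u _ => mul_nonneg (hc0 u) (hB0 u)
    linarith
  set b : Fin n → ℝ := fun i => 2 * (s * ∑ u, c u * (u.1 i : ℝ)) with hb
  have hint := (integrableOn_prod_norm_rpow (b := b)
    (fun i => by have := hc i; simp only [hb]; linarith)).const_mul (C ^ s)
  refine lt_of_le_of_lt (lintegral_mono_ae ?_) hint.lintegral_lt_top
  have hne : ∀ᵐ z : Fin n → ℂ, ∀ i, z i ≠ 0 :=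
    ae_all_iff.2 fun i => Measure.ae_eval_ne (μ := fun _ : Fin n => (volume : Measure ℂ)) i 0
  filter_upwards [ae_restrict_of_ae hne, ae_restrict_mem measurableSet_ball] with z hz0 hz
  have hpos : ∀ i, 0 < ‖z i‖ := fun i => norm_pos_iff.2 (hz0 i)
  set F := ∑ i, ‖MvPolynomial.eval z (f i)‖ ^ 2 with hF
  have hF0 : 0 ≤ F := by positivity
  -- Weighted AM-GM: the `c u` sum to `1`.
  have h1 : ∏ u, ((∏ i, ‖z i‖ ^ u.1 i) ^ 2) ^ c u ≤ C * F := by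
    refine (Real.geom_mean_le_arith_mean_weighted _ _ _ (fun u _ => hc0 u) hc1
      (fun u _ => by positivity)).trans ?_
    calc ∑ u, c u * (∏ i, ‖z i‖ ^ u.1 i) ^ 2 ≤ ∑ u, c u * (B u * F) :=
          Finset.sum_le_sum fun u _ => mul_le_mul_of_nonneg_left (hB u z hz) (hc0 u)
      _ = (∑ u, c u * B u) * F := by rw [Finset.sum_mul]; simp only [mul_assoc]
      _ ≤ C * F := by gcongr; simp [hC]
  have h2 : (∏ u, ((∏ i, ‖z i‖ ^ u.1 i) ^ 2) ^ c u) ^ (-s) = ∏ i, ‖z i‖ ^ (-b i) := by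
    have hu : ∀ u : U, ((∏ i, ‖z i‖ ^ u.1 i) ^ 2) ^ c u =
        ∏ i, ‖z i‖ ^ (2 * (c u * (u.1 i : ℝ))) := by
      intro u
      rw [← Finset.prod_pow, ← Real.finsetProd_rpow _ _ fun i _ => by positivity]
      refine Finset.prod_congr rfl fun i _ => ?_
      rw [← Real.rpow_natCast, ← Real.rpow_natCast, ← Real.rpow_mul (hpos i).le,
        ← Real.rpow_mul (hpos i).le]
      congr 1
      push_cast
      ring
    simp only [hu]
    rw [Finset.prod_comm, ← Real.finsetProd_rpow _ _ fun i _ => by positivity]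
    refine Finset.prod_congr rfl fun i _ => ?_
    rw [← Real.rpow_sum_of_pos (hpos i), ← Real.rpow_mul (hpos i).le, ← Finset.mul_sum]
    congr 1
    simp only [hb]
    ring
  have hm0 : 0 < ∏ u, ((∏ i, ‖z i‖ ^ u.1 i) ^ 2) ^ c u :=
    Finset.prod_pos fun u _ => Real.rpow_pos_of_pos
      (pow_pos (Finset.prod_pos fun i _ => pow_pos (hpos i) _) _) _
  have hFpos : 0 < F := by
    by_contra! h
    have : F = 0 := le_antisymm h hF0
    rw [this, mul_zero] at h1
    linarith
  rw [one_div, ← ENNReal.rpow_neg, ENNReal.ofReal_rpow_of_pos hFpos]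
  refine ENNReal.ofReal_le_ofReal ?_
  rw [← h2]
  calc F ^ (-s) = C ^ s * (C * F) ^ (-s) := by
        rw [Real.mul_rpow hC0.le hF0, ← mul_assoc, ← Real.rpow_add hC0]; simp
    _ ≤ _ := mul_le_mul_of_nonneg_left
        (Real.rpow_le_rpow_of_nonpos hm0 h1 (neg_nonpos.2 hs.le)) (by positivity)


/-! ### Exponents of the generators and the two inequalities. -/

/-- The exponents of the monomials occurring in a finite family of polynomials. -/
def exponents {n r : ℕ} (f : Fin r → MvPolynomial (Fin n) ℂ) : Finset (Fin n →₀ ℕ) :=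
  Finset.univ.biUnion fun i => (f i).support

theorem mem_exponents {n r : ℕ} {f : Fin r → MvPolynomial (Fin n) ℂ} {u : Fin n →₀ ℕ} :
    u ∈ exponents f ↔ ∃ i, u ∈ (f i).support := by
  simp [exponents]

theorem exists_exponent_le {n r : ℕ} {f : Fin r → MvPolynomial (Fin n) ℂ}
    {p : MvPolynomial (Fin n) ℂ} (hp : p ∈ Ideal.span (Set.range f)) {d : Fin n →₀ ℕ}
    (hd : d ∈ p.support) : ∃ u ∈ exponents f, u ≤ d := by
  have hle : Ideal.span (Set.range f) ≤
      Ideal.span ((fun u => MvPolynomial.monomial u (1 : ℂ)) '' (exponents f : Set _)) := by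
    rw [Ideal.span_le]
    rintro _ ⟨i, rfl⟩
    exact MvPolynomial.mem_ideal_span_monomial_image.2 fun u hu =>
      ⟨u, mem_exponents.2 ⟨i, hu⟩, le_rfl⟩
  exact MvPolynomial.mem_ideal_span_monomial_image.1 (hle hp) d hd

theorem IsMonomialIdeal.monomial_mem {n : ℕ} {a : Ideal (MvPolynomial (Fin n) ℂ)}
    (ha : IsMonomialIdeal a) {p : MvPolynomial (Fin n) ℂ} (hp : p ∈ a) {u : Fin n →₀ ℕ}
    (hu : u ∈ p.support) : MvPolynomial.monomial u 1 ∈ a := by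
  obtain ⟨S, rfl⟩ := ha
  refine MvPolynomial.mem_ideal_span_monomial_image.2 fun v hv => ?_
  obtain rfl : v = u := by simpa using MvPolynomial.support_monomial_subset hv
  exact MvPolynomial.mem_ideal_span_monomial_image.1 hp v hu

theorem exponents_nonempty {n r : ℕ} {f : Fin r → MvPolynomial (Fin n) ℂ}
    (hf : Ideal.span (Set.range f) ≠ ⊥) : (exponents f).Nonempty := by
  by_contra! h
  refine hf (Ideal.span_eq_bot.2 ?_)
  rintro _ ⟨i, rfl⟩
  by_contra hi
  obtain ⟨u, hu⟩ := MvPolynomial.support_nonempty.2 hi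
  have := mem_exponents.2 ⟨i, hu⟩
  simp [h] at this

variable {n r : ℕ} {f : Fin r → MvPolynomial (Fin n) ℂ}

theorem lct_le_gStableRank (hmon : IsMonomialIdeal (Ideal.span (Set.range f)))
    (hne : (exponents f).Nonempty) :
    lct 0 f ≤ gStableRank (MvPolynomial.vanishingIdeal ℂ {(0 : Fin n → ℂ)}) n
      (Ideal.span (Set.range f)) := by
  refine iSup₂_le fun s hs => le_iInf₂ fun T hT => le_iInf₂ fun l hl => ?_
  obtain ⟨hs0, V, hV, hfin⟩ := hs
  obtain ⟨τ, hτ⟩ := exists_perm_order_le hT l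
  obtain ⟨u, hu, hmin⟩ := (exponents f).exists_min_image (Finsupp.weight (l ∘ τ)) hne
  have hk : s * (Finsupp.weight (l ∘ τ) u : ℕ) ≤ ∑ i, ((l ∘ τ) i : ℝ) :=
    mul_le_sum_of_lintegral_lt_top f hs0 hV hfin fun i d hd =>
      hmin d (mem_exponents.2 ⟨i, hd⟩)
  have hsum : ∑ i, ((l ∘ τ) i : ℝ) = ((∑ i, l i : ℕ) : ℝ) := by
    push_cast
    exact Equiv.sum_comp τ fun i => (l i : ℝ)
  rw [hsum] at hk
  obtain ⟨i, hi⟩ := mem_exponents.1 hu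
  have hord := hτ _ u (hmon.monomial_mem (Ideal.subset_span ⟨i, rfl⟩) hi)
  have hl0 : (∑ i, l i) ≠ 0 := fun h => hl (funext fun i =>
    Finset.sum_eq_zero_iff.1 h i (Finset.mem_univ i))
  -- The numerator is nonzero and finite, so the quotients `0 / 0` and `∞ / ∞` do not arise.
  rw [slope, ENNReal.le_div_iff_mul_le (Or.inr (by exact_mod_cast hl0))
    (Or.inr (ENNReal.natCast_ne_top _))]
  calc ENNReal.ofReal s * _ ≤ ENNReal.ofReal s * ((Finsupp.weight (l ∘ τ) u : ℕ) : ℝ≥0∞) := by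
        gcongr
        exact_mod_cast ENat.toENNReal_mono hord
    _ = ENNReal.ofReal (s * (Finsupp.weight (l ∘ τ) u : ℕ)) := by
        rw [ENNReal.ofReal_mul hs0.le, ENNReal.ofReal_natCast]
    _ ≤ _ := by
        rw [← ENNReal.ofReal_natCast]
        exact ENNReal.ofReal_le_ofReal hk

theorem gStableRank_le_lct (hmon : IsMonomialIdeal (Ideal.span (Set.range f)))
    (hne : (exponents f).Nonempty) :
    gStableRank (MvPolynomial.vanishingIdeal ℂ {(0 : Fin n → ℂ)}) n (Ideal.span (Set.range f)) ≤
      lct 0 f := by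
  by_contra! hlt
  obtain ⟨q, hq1, hq⟩ := ENNReal.lt_iff_exists_nnreal_btwn.1 hlt
  -- Integrability is shown at `q`; the larger `q'`, still below the rank, supplies the slack for
  -- the convexity lemma.
  obtain ⟨q', hqq', hq'⟩ := ENNReal.lt_iff_exists_nnreal_btwn.1 hq
  have hq0 : 0 < (q : ℝ) := by
    exact_mod_cast (ENNReal.coe_pos.1 (bot_le.trans_lt hq1))
  have hrank : ∀ l : Fin n → ℕ, l ≠ 0 → ∀ k : ℕ, (∀ u ∈ exponents f, k ≤ Finsupp.weight l u) →
      (q' : ℝ) * k ≤ ∑ i, (l i : ℝ) := by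
    intro l hl k hk
    have hord : (k : ℕ∞) ≤ order (MvPolynomial.vanishingIdeal ℂ {(0 : Fin n → ℂ)}) coordinates l
        (Ideal.span (Set.range f)) := by
      refine le_order_coordinates l _ fun p hp d hd => ?_
      obtain ⟨u, hu, hud⟩ := exists_exponent_le hp hd
      obtain ⟨e, rfl⟩ := exists_add_of_le hud
      rw [map_add]
      exact (hk u hu).trans le_self_add
    have hslope : (q' : ℝ≥0∞) ≤ ((∑ i, l i : ℕ) : ℝ≥0∞) / k := by
      refine hq'.le.trans ((iInf₂_le coordinates isLocalParameters_coordinates).trans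
        ((iInf₂_le l hl).trans ?_))
      refine ENNReal.div_le_div_left ?_ _
      exact_mod_cast ENat.toENNReal_mono hord
    have := ENNReal.mul_le_of_le_div hslope
    have h2 : q' * (k : NNReal) ≤ ((∑ i, l i : ℕ) : NNReal) := by exact_mod_cast this
    exact_mod_cast h2
  obtain ⟨c, hc0, hc1, hc⟩ := exists_convex_weights (exponents f) hne hq0
    (by exact_mod_cast hqq') hrank
  have hfin := lintegral_lt_top_of_convex_weights f (exponents f) (fun u hu => by
    obtain ⟨i, hi⟩ := mem_exponents.1 hu
    exact hmon.monomial_mem (Ideal.subset_span ⟨i, rfl⟩) hi) hq0 c hc0 hc1 hc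
  have : ENNReal.ofReal q ≤ lct 0 f :=
    le_iSup₂_of_le (q : ℝ) ⟨hq0, _, Metric.ball_mem_nhds 0 one_pos, hfin⟩ le_rfl
  rw [ENNReal.ofReal_coe_nnreal] at this
  exact absurd hq1 (not_lt.2 this)

end GStable

end

theorem theorem1p7 (n : ℕ) (a : Ideal (MvPolynomial (Fin n) ℂ))
    (hmon : GStable.IsMonomialIdeal a) (hproper : a ≠ ⊤) (hnonzero : a ≠ ⊥)
    (r : ℕ) (f : Fin r → MvPolynomial (Fin n) ℂ) (hf : Ideal.span (Set.range f) = a) :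
    GStable.lct (0 : Fin n → ℂ) f =
      GStable.gStableRank (MvPolynomial.vanishingIdeal ℂ {(0 : Fin n → ℂ)}) n a := by
  subst hf
  exact le_antisymm (GStable.lct_le_gStableRank hmon (GStable.exponents_nonempty hnonzero))
    (GStable.gStableRank_le_lct hmon (GStable.exponents_nonempty hnonzero))
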